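/- **Setting.** Let $A\in\mathbb R^{d\times d}$, $b\in\mathbb R^d$, and consider the single-input system $\dot x=Ax+b(u+f(x))$ on $\mathbb R^d$ with an unknown nonlinearity $f$, and a bounded reference with $\dot x_{\rm ref}=Ax_{\rm ref}+b\,r_{\rm ref}$ on $[0,\infty)$ such that every reference point $x_{\rm ref}(t)$, $t\ge 0$, is attained at some time in $[0,T_p]$ (for instance a $T_p$-periodic reference), where $T_p>0$ is the execution time of an episode. For gains $\theta$ in an admissible set $\Theta\subseteq\mathbb R^d$ let $A_\theta=A-b\theta^{T}$; assume that for $\theta\in\Theta$ the eigenvalues of $A_\theta$ are distinct with non-positive real parts, and that $\lambda_{\max}(A_\theta)\le-\alpha(\|\theta\|)$ for some class $\mathcal K_\infty$ function $\alpha$, where $\lambda_{\max}$ is the largest real part of an eigenvalue. For an eigendecomposition $A_\theta=U\Lambda U^{-1}$ put $\zeta=\|U\|\,\|U^{-1}b\|$. Let $k:\mathbb R^d\to\mathbb R$ be a stationary covariance kernel ($k(x,x')=k(x-x')$) that is $L_k$-Lipschitz and differentiable with $L_{\partial k}$-Lipschitz gradient, $L_{\partial k}>0$, $k(0)>0$.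 On a probability space, $f$ is a sample of the Gaussian process $\mathcal{GP}(0,k)$, and the measurement noise is i.i.d. $\mathcal N(0,\sigma_{\rm on}^2)$, $\sigma_{\rm on}>0$, independent of $f$. Let $\mathbb X\subset\mathbb R^d$ be a compact set that contains the reference, and let $L_f$ (possibly depending on the sample) be a Lipschitz constant of $f$ on $\mathbb X$. For a data set with inputs $x^{(n)}$ and targets $y$, kernel matrix $K=(k(x^{(i)}-x^{(j)}))_{ij}$ and kernel vector $\mathbf k(x)=(k(x-x^{(i)}))_i$, let $\mu(x)=\mathbf k(x)^T(K+\sigma_{\rm on}^2I)^{-1}y$ and $\sigma^2(x)=k(0)-\mathbf k(x)^T(K+\sigma_{\rm on}^2I)^{-1}\mathbf k(x)$ (so $\mu=0$, $\sigma^2=k(0)$ without data), and let $L_\mu$ be a Lipschitz constant of $\mu$ on $\mathbb X$. For $\delta\in(0,1)$ and $\tau>0$ put $$\beta_{\mathbb X}(\tau)=2\log\frac{M(\tau,\mathbb X)}{\delta},\qquad L_\sigma=\sup_{\substack{x,x'\in\mathbb X\\ k(x-x')\neq k(0)}}\frac{\|\nabla k(x-x')\|}{\sqrt{2k(0)-2k(x-x')}},$$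 $$\gamma(\tau)=(L_\mu+L_f)\tau+\sqrt{\beta_{\mathbb X}(\tau)}\,L_\sigma\tau,\qquad \eta(x)=\sqrt{\beta_{\mathbb X}(\tau)}\,\sigma(x)+\gamma(\tau),$$ where $M(\tau,\mathbb X)$ is the $\tau$-covering number of $\mathbb X$ (a supremum over the empty set is read as $0$). **Algorithm.** Let $\bar e>0$ and $\xi\in(0,1)$. Model $0$ is the GP without data. For each model $i$ one chooses gains $\theta_i\in\Theta$ (with an eigendecomposition of $A_{\theta_i}$) and $\tau_i>0$ with $\sup_{t\ge0}\sigma_i(x_{\rm ref}(t))\ge\gamma_i(\tau_i)/\sqrt{\beta_{\mathbb X}(\tau_i)}$, and computes $$\bar\upsilon_i=-\frac{\zeta_i}{\lambda_{\max}(A_{\theta_i})+L_\sigma\zeta_i\sqrt{\beta_{\mathbb X}(\tau_i)}}\ \sup_{t\ge0}\eta_i(x_{\rm ref}(t)).$$ If $\bar\upsilon_i\le\bar e$, the algorithm terminates, after $i$ episodes. Otherwise episode $i+1$ is performed: the controller $u=-\theta_i^T(x-x_{\rm ref})+r_{\rm ref}-\mu_i(x)$ is run from $x(0)=x_{\rm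 ref}(0)$, a sampling time $T_s>0$ is chosen, and model $i+1$ is the GP trained on the $\lfloor1+T_p/T_s\rfloor$ noisy samples of $f$ at the points $x(0),x(T_s),x(2T_s),\dots$ of this closed-loop trajectory on $[0,T_p]$. The closed-loop solution under the controller of each computed model is assumed to exist on $[0,\infty)$. All choices may depend on the realization. **Theorem.** Consider the conditions $$-\lambda_{\max}(A_{\theta_i})\ \ge\ \frac{8\sqrt{L_{\partial k}}+\xi L_\sigma}{\xi}\,\zeta_i\sqrt{\beta_{\mathbb X}(\tau_i)}\qquad\text{(eigenvalue condition)},$$ $$\max_{0\le t\le T_p}\sigma_i^2(x_{\rm ref}(t))\ \le\ 16\,L_{\partial k}\,\bar\upsilon_{i-1}^2\qquad\text{(variance condition)}.$$ Assume that the eigenvalue condition holds almost surely for $i=0$ and that, for each $i=1,\dots,N_E$, the event that episode $i$ is performed and one of the two conditions fails for $i$ has probability at most $\delta$ (in particular this holds if the conditions hold in every episode), where $$N_E=\max\Big\{0,\Big\lceil\frac{\log\big(4\bar e\sqrt{L_{\partial k}}\big)-\log\sqrt{k(0)}}{\log\xi}\Big\rceil\Big\}.$$ Then there is an event of probability at least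 $1-N_E\delta$ on which the algorithm terminates after some number $n\le N_E$ of episodes, i.e. it reaches the tracking error bound $\bar\upsilon_n\le\bar e$, and the bounds decay geometrically, $\bar\upsilon_i\le\xi^i\bar\upsilon_0$ for $0\le i\le n$. Moreover, on this event, for every $i\le n$ for which the learning error bound is valid ($|f-\mu_i|\le\eta_i$ on $\mathbb X$) and $\mathbb X$ contains the closed $\bar\upsilon_i$-neighbourhood of every $x_{\rm ref}(t)$, $t\geq 0$, the closed-loop trajectory $x$ with the controller of model $i$ satisfies $\|x(t)-x_{\rm ref}(t)\|\le\bar\upsilon_i$ for all $t\ge0$. -/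

import Mathlib

open MeasureTheory ProbabilityTheory Set Filter Topology
open scoped NNReal ENNReal Matrix

noncomputable section

namespace EpisodicGP

/-- The state space `ℝ^d` with its Euclidean norm. -/
abbrev State (d : ℕ) := EuclideanSpace ℝ (Fin d)

/-! ### Gaussian process regression with a stationary kernel `k(x, x') = k(x - x')` -/

/-- A finite training data set `{(x^(n), y^(n))}`. -/
structure DataSet (d : ℕ) where
  /-- number of training samples -/
  N : ℕ
  /-- inputs -/
  input : Fin N → State d
  /-- targets -/
  target : Fin N → ℝ

/-- The kernel matrix `K_{ij} = k(x^(i) - x^(j))`. -/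
def gram {d : ℕ} (k : State d → ℝ) {N : ℕ} (z : Fin N → State d) : Matrix (Fin N) (Fin N) ℝ :=
  Matrix.of fun i j => k (z i - z j)

/-- The kernel vector `k_i(x) = k(x - x^(i))`. -/
def kvec {d : ℕ} (k : State d → ℝ) {N : ℕ} (z : Fin N → State d) (x : State d) : Fin N → ℝ :=
  fun i => k (x - z i)

/-- `k` defines a (stationary) covariance kernel: all kernel matrices are symmetric and positive
semidefinite. -/
def IsStationaryKernel {d : ℕ} (k : State d → ℝ) : Prop :=
  ∀ (N : ℕ) (z : Fin N → State d), (gram k z).PosSemidef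

/-- Posterior mean `μ(x) = k(x)ᵀ (K + σ_on² I)⁻¹ y`; it is `0` for the empty data set. -/
def posteriorMean {d : ℕ} (k : State d → ℝ) (son : ℝ) (D : DataSet d) (x : State d) : ℝ :=
  kvec k D.input x ⬝ᵥ ((gram k D.input + son ^ 2 • (1 : Matrix (Fin D.N) (Fin D.N) ℝ))⁻¹ *ᵥ D.target)

/-- Posterior variance `σ²(x) = k(0) - k(x)ᵀ (K + σ_on² I)⁻¹ k(x)`; it is `k(0)` for the empty data
set. -/
def posteriorVar {d : ℕ} (k : State d → ℝ) (son : ℝ) (D : DataSet d) (x : State d) : ℝ :=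
  k 0 - kvec k D.input x ⬝ᵥ
    ((gram k D.input + son ^ 2 • (1 : Matrix (Fin D.N) (Fin D.N) ℝ))⁻¹ *ᵥ kvec k D.input x)

/-- Posterior standard deviation. -/
def posteriorStd {d : ℕ} (k : State d → ℝ) (son : ℝ) (D : DataSet d) (x : State d) : ℝ :=
  √(posteriorVar k son D x)

/-- The Lipschitz constant of the posterior standard deviation of a GP with stationary kernel,
`L_σ = sup_{r = x - x', x, x' ∈ X} (2 k(0) - 2 k(r))^{-1/2} ‖∇k(r)‖`
(points `r` with `k(r) = k(0)`, such as `r = 0`, contribute `0`). -/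
def Lsigma {d : ℕ} (k : State d → ℝ) (X : Set (State d)) : ℝ :=
  sSup {c | ∃ x ∈ X, ∃ x' ∈ X,
    c = √(1 / (2 * k 0 - 2 * k (x - x'))) * ‖gradient k (x - x')‖}

/-- `β_X(τ) = 2 log (M(τ, X) / δ)` with the `τ`-covering number `M(τ, X)`. -/
def beta {d : ℕ} (X : Set (State d)) (δ : ℝ) (τ : ℝ≥0) : ℝ :=
  2 * Real.log ((Metric.externalCoveringNumber τ X).toNat / δ)

/-- `γ(τ) = (L_μ + L_f) τ + √β_X(τ) ω_σ(τ)` with the modulus of continuity `ω_σ(τ) = L_σ τ`. -/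
def gamma {d : ℕ} (k : State d → ℝ) (X : Set (State d)) (δ : ℝ) (Lmu Lf τ : ℝ≥0) : ℝ :=
  (Lmu + Lf) * τ + √(beta X δ τ) * (Lsigma k X * τ)

/-- The learning error bound `η(x) = √β_X(τ) σ(x) + γ(τ)`. -/
def etaBound {d : ℕ} (k : State d → ℝ) (X : Set (State d)) (δ son : ℝ) (Lmu Lf τ : ℝ≥0)
    (D : DataSet d) (x : State d) : ℝ :=
  √(beta X δ τ) * posteriorStd k son D x + gamma k X δ Lmu Lf τ

/-! ### Linear systems, gains, eigenvalues -/

/-- `A_θ = A - b θᵀ`. -/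
def closedLoop {d : ℕ} (A : Matrix (Fin d) (Fin d) ℝ) (b θ : State d) :
    Matrix (Fin d) (Fin d) ℝ :=
  A - Matrix.vecMulVec (fun i => b i) (fun i => θ i)

/-- A real matrix, regarded as a complex one. -/
def complexify {d : ℕ} (B : Matrix (Fin d) (Fin d) ℝ) : Matrix (Fin d) (Fin d) ℂ :=
  B.map Complex.ofReal

/-- `λ_max(B)`, the largest (real part of an) eigenvalue of `B`. -/
def lambdaMax {d : ℕ} (B : Matrix (Fin d) (Fin d) ℝ) : ℝ :=
  sSup (Complex.re '' spectrum ℂ (complexify B))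

/-- The eigenvalues of `B` are distinct and have non-positive real parts. -/
def HasDistinctNonposEigenvalues {d : ℕ} (B : Matrix (Fin d) (Fin d) ℝ) : Prop :=
  (spectrum ℂ (complexify B)).ncard = d ∧ ∀ l ∈ spectrum ℂ (complexify B), l.re ≤ 0

/-- Class `𝒦_∞` functions on `[0, ∞)`. -/
def IsClassKInfty (α : ℝ → ℝ) : Prop :=
  ContinuousOn α (Ici 0) ∧ StrictMonoOn α (Ici 0) ∧ α 0 = 0 ∧ Tendsto α atTop atTop

/-- `B = U Λ U⁻¹` with `U` invertible and `Λ` diagonal. -/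
def IsEigendecomposition {d : ℕ} (B : Matrix (Fin d) (Fin d) ℝ)
    (U : Matrix (Fin d) (Fin d) ℂ) : Prop :=
  IsUnit U.det ∧ ∃ Λ : Fin d → ℂ, complexify B = U * Matrix.diagonal Λ * U⁻¹

/-- `ζ = ‖U‖ ‖U⁻¹ b‖` with the spectral and the Euclidean norm. -/
def zeta {d : ℕ} (U : Matrix (Fin d) (Fin d) ℂ) (b : State d) : ℝ :=
  ‖Matrix.toEuclideanCLM (n := Fin d) (𝕜 := ℂ) U‖ *
    ‖(WithLp.toLp 2 (U⁻¹ *ᵥ fun i => (b i : ℂ)) : EuclideanSpace ℂ (Fin d))‖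

/-! ### The tracking problem -/

/-- The known data of the tracking problem. -/
structure Problem (d : ℕ) where
  /-- system matrix -/
  A : Matrix (Fin d) (Fin d) ℝ
  /-- input vector -/
  b : State d
  /-- the admissible control gains -/
  Gains : Set (State d)
  /-- reference trajectory -/
  xref : ℝ → State d
  /-- reference signal -/
  rref : ℝ → ℝ
  /-- the domain of the learning error bound -/
  X : Set (State d)
  /-- the stationary kernel, as a function of `x - x'` -/
  k : State d → ℝ
  /-- Lipschitz constant of the kernel -/
  Lk : ℝ≥0
  /-- Lipschitz constant of the derivative of the kernel -/
  Ldk : ℝ≥0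
  /-- standard deviation of the measurement noise -/
  son : ℝ
  /-- failure probability -/
  δ : ℝ
  /-- execution time of an episode -/
  Tp : ℝ
  /-- decay factor -/
  ξ : ℝ
  /-- prescribed tracking error bound -/
  ebar : ℝ

/-- The standing assumptions on the known data. -/
structure Problem.Valid {d : ℕ} (p : Problem d) : Prop where
  eigenvalues : ∀ θ ∈ p.Gains, HasDistinctNonposEigenvalues (closedLoop p.A p.b θ)
  classK : ∃ α, IsClassKInfty α ∧ ∀ θ ∈ p.Gains, lambdaMax (closedLoop p.A p.b θ) ≤ -α ‖θ‖
  reference : ∀ t, 0 ≤ t → HasDerivWithinAt p.xref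
    (WithLp.toLp 2 (p.A *ᵥ fun i => p.xref t i) + p.rref t • p.b) (Ici 0) t
  reference_bounded : Bornology.IsBounded (p.xref '' Ici 0)
  /-- an episode runs through the whole reference, e.g. one period of a periodic reference -/
  reference_episode : ∀ t, 0 ≤ t → ∃ s ∈ Icc 0 p.Tp, p.xref s = p.xref t
  compact : IsCompact p.X
  reference_mem : ∀ t, 0 ≤ t → p.xref t ∈ p.X
  kernel : IsStationaryKernel p.k
  kernel_lipschitz : LipschitzWith p.Lk p.k
  kernel_differentiable : Differentiable ℝ p.k
  kernel_deriv_lipschitz : LipschitzWith p.Ldk (gradient p.k)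
  kernel_zero_pos : 0 < p.k 0
  Ldk_pos : 0 < p.Ldk
  son_pos : 0 < p.son
  δ_mem : p.δ ∈ Ioo 0 1
  Tp_pos : 0 < p.Tp
  ξ_mem : p.ξ ∈ Ioo 0 1
  ebar_pos : 0 < p.ebar

/-! ### A run of the episodic learning algorithm

Index `0` refers to the prior model (`μ = 0`, `σ² = k(0)`); index `i + 1` refers to the model
learned from the data of episode `i + 1`, in which the controller built from model `i` is run. -/

/-- The quantities that are chosen or observed in one realization of the algorithm. -/
structure Run (d : ℕ) where
  /-- control gains used with model `i` -/
  θ : ℕ → State d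
  /-- eigenvector matrix of `A_{θ i}` -/
  U : ℕ → Matrix (Fin d) (Fin d) ℂ
  /-- grid constant of the learning error bound of model `i` -/
  τ : ℕ → ℝ≥0
  /-- Lipschitz constant of the posterior mean of model `i` -/
  Lmu : ℕ → ℝ≥0
  /-- Lipschitz constant of the unknown function -/
  Lf : ℝ≥0
  /-- sampling time of the data of episode `i` (for `i ≥ 1`) -/
  Ts : ℕ → ℝ
  /-- closed-loop trajectory generated by the controller built from model `i` -/
  x : ℕ → ℝ → State d

variable {d : ℕ}

/-- The data set of model `i`: no data for `i = 0`; for model `i + 1`, the `⌊1 + T_p / T_s⌋` noisy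
samples of `f` along the trajectory of episode `i + 1`, at the times `0, T_s, 2 T_s, …` in
`[0, T_p]`. -/
def Run.data (R : Run d) (p : Problem d) (f : State d → ℝ) (ε : ℕ → ℕ → ℝ) : ℕ → DataSet d
  | 0 => { N := 0, input := fun _ => 0, target := fun _ => 0 }
  | i + 1 =>
    { N := ⌊1 + p.Tp / R.Ts (i + 1)⌋₊
      input := fun j => R.x i ((j : ℕ) * R.Ts (i + 1))
      target := fun j => f (R.x i ((j : ℕ) * R.Ts (i + 1))) + ε (i + 1) j }

/-- Posterior mean of model `i`. -/
def Run.mean (R : Run d) (p : Problem d) (f : State d → ℝ) (ε : ℕ → ℕ → ℝ) (i : ℕ) : State d → ℝ :=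
  posteriorMean p.k p.son (R.data p f ε i)

/-- Posterior variance of model `i`. -/
def Run.var (R : Run d) (p : Problem d) (f : State d → ℝ) (ε : ℕ → ℕ → ℝ) (i : ℕ) : State d → ℝ :=
  posteriorVar p.k p.son (R.data p f ε i)

/-- Posterior standard deviation of model `i`. -/
def Run.std (R : Run d) (p : Problem d) (f : State d → ℝ) (ε : ℕ → ℕ → ℝ) (i : ℕ) : State d → ℝ :=
  posteriorStd p.k p.son (R.data p f ε i)

/-- Learning error bound of model `i`. -/
def Run.eta (R : Run d) (p : Problem d) (f : State d → ℝ) (ε : ℕ → ℕ → ℝ) (i : ℕ) : State d → ℝ :=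
  etaBound p.k p.X p.δ p.son (R.Lmu i) R.Lf (R.τ i) (R.data p f ε i)

/-- `λ_max(A_θ)` for the gains used with model `i`. -/
def Run.lam (R : Run d) (p : Problem d) (i : ℕ) : ℝ := lambdaMax (closedLoop p.A p.b (R.θ i))

/-- `√β_X(τ)` for model `i`. -/
def Run.sqrtBeta (R : Run d) (p : Problem d) (i : ℕ) : ℝ := √(beta p.X p.δ (R.τ i))

/-- The tracking error bound `ῡ_i = - ζ / (λ_max(A_θ) + L_σ ζ √β_X(τ)) · sup_{t ≥ 0} η(x_ref(t))`. -/
def Run.bound (R : Run d) (p : Problem d) (f : State d → ℝ) (ε : ℕ → ℕ → ℝ) (i : ℕ) : ℝ :=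
  -(zeta (R.U i) p.b / (R.lam p i + Lsigma p.k p.X * zeta (R.U i) p.b * R.sqrtBeta p i)) *
    ⨆ t : Ici (0 : ℝ), R.eta p f ε i (p.xref t)

/-- Model `i` is computed, i.e. the loop condition `ῡ_j > ē` held for all earlier models. -/
def Run.Active (R : Run d) (p : Problem d) (f : State d → ℝ) (ε : ℕ → ℕ → ℝ) (i : ℕ) : Prop :=
  ∀ j < i, p.ebar < R.bound p f ε j

/-- The algorithm terminates after exactly `n` episodes. -/
def Run.TerminatesAfter (R : Run d) (p : Problem d) (f : State d → ℝ) (ε : ℕ → ℕ → ℝ)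
    (n : ℕ) : Prop :=
  R.Active p f ε n ∧ R.bound p f ε n ≤ p.ebar

/-- The control law `u = -θᵀ (x - x_ref) + r_ref - μ(x)` built from model `i`. -/
def Run.control (R : Run d) (p : Problem d) (f : State d → ℝ) (ε : ℕ → ℕ → ℝ) (i : ℕ)
    (t : ℝ) (x : State d) : ℝ :=
  -inner ℝ (R.θ i) (x - p.xref t) + p.rref t - R.mean p f ε i x

/-- The realization `R` follows the algorithm for the unknown function `f` and the measurement
noise `ε`. -/
structure Run.Follows (R : Run d) (p : Problem d) (f : State d → ℝ) (ε : ℕ → ℕ → ℝ) : Prop where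
  lipschitz : LipschitzOnWith R.Lf f p.X
  gains : ∀ i, R.Active p f ε i → R.θ i ∈ p.Gains
  eigen : ∀ i, R.Active p f ε i → IsEigendecomposition (closedLoop p.A p.b (R.θ i)) (R.U i)
  /-- `x i` solves `ẋ = A x + b (u + f(x))`, `x(0) = x_ref(0)` -/
  start : ∀ i, R.Active p f ε i → R.x i 0 = p.xref 0
  dynamics : ∀ i, R.Active p f ε i → ∀ t, 0 ≤ t → HasDerivWithinAt (R.x i)
    (WithLp.toLp 2 (p.A *ᵥ fun j => R.x i t j) +
      (R.control p f ε i t (R.x i t) + f (R.x i t)) • p.b) (Ici 0) t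
  sampling_pos : ∀ i, 1 ≤ i → R.Active p f ε i → 0 < R.Ts i
  mean_lipschitz : ∀ i, R.Active p f ε i → LipschitzOnWith (R.Lmu i) (R.mean p f ε i) p.X
  tau_pos : ∀ i, R.Active p f ε i → 0 < R.τ i
  /-- `τ` is chosen such that `sup_{t ≥ 0} σ(x_ref(t)) ≥ γ(τ) / √β_X(τ)` -/
  tau_cond : ∀ i, R.Active p f ε i →
    gamma p.k p.X p.δ (R.Lmu i) R.Lf (R.τ i) / R.sqrtBeta p i ≤
      ⨆ t : Ici (0 : ℝ), R.std p f ε i (p.xref t)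

/-- The eigenvalue condition
`-λ_max(A_θ) ≥ (8 √L_∂k + ξ L_σ) / ξ · ζ √β_X(τ)` for the gains used with model `i`. -/
def Run.GainCond (R : Run d) (p : Problem d) (i : ℕ) : Prop :=
  (8 * √(p.Ldk : ℝ) + p.ξ * Lsigma p.k p.X) / p.ξ * zeta (R.U i) p.b * R.sqrtBeta p i ≤ -R.lam p i

/-- The variance condition `max_{0 ≤ t ≤ T_p} σ²_{T_s}(x_ref(t)) ≤ 16 L_∂k ῡ_{i-1}²`
for the data of episode `i ≥ 1`. -/
def Run.SamplingCond (R : Run d) (p : Problem d) (f : State d → ℝ) (ε : ℕ → ℕ → ℝ)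
    (i : ℕ) : Prop :=
  ∀ t ∈ Icc 0 p.Tp, R.var p f ε i (p.xref t) ≤ 16 * p.Ldk * R.bound p f ε (i - 1) ^ 2

/-- The bound `η_i` is valid on `X` and `X` contains the `ῡ_i`-neighbourhood of the reference. -/
def Run.ModelValid (R : Run d) (p : Problem d) (f : State d → ℝ) (ε : ℕ → ℕ → ℝ) (i : ℕ) : Prop :=
  (∀ x ∈ p.X, |f x - R.mean p f ε i x| ≤ R.eta p f ε i x) ∧
    ∀ t, 0 ≤ t → Metric.closedBall (p.xref t) (R.bound p f ε i) ⊆ p.X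

/-- The maximal number of episodes,
`⌈(log (4 ē √L_∂k) - log √k(0)) / log ξ⌉` (read as `0` if it is negative). -/
def Problem.maxEpisodes (p : Problem d) : ℕ :=
  ⌈(Real.log (4 * p.ebar * √(p.Ldk : ℝ)) - Real.log (√(p.k 0))) / Real.log p.ξ⌉₊

end EpisodicGP

end

noncomputable section

namespace EpisodicGP

/-! ### Posterior variance and the kernel metric. -/

section Kernel

variable {d : ℕ} {k : State d → ℝ}

/-! Two deterministic arguments hold for each realization; a union bound over the failure events of
the at most `N_E` episodes gives the probability.

Decay. The choice of `τ` gives `γ ≤ √β sup σ` along the reference, hence `sup η ≤ 2 √β sup σ`. The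
eigenvalue condition bounds the denominator of `ῡ_i` below by `8 √L_∂k ζ √β / ξ`, so `4 √L_∂k ῡ_i ≤
ξ sup σ_i` (`Run.bound_le`). The variance condition says `sup σ_i ≤ 4 √L_∂k ῡ_{i-1}`, and together
`ῡ_i ≤ ξ ῡ_{i-1}`. As `σ_0 ≤ √k(0)`, after `N_E` episodes without termination the bound would
already be at most `ē`.

Tracking. The error satisfies `ė = A_θ e + b (f - μ)`, `e(0) = 0`. Diagonalizing `A_θ` gives `‖e(T)‖
≤ ζ G (1 - exp(λ_max T)) / (-λ_max)` when `|f - μ| ≤ G` before time `T` (`norm_le_of_forced`). While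
`‖e‖ ≤ ῡ`, one may take `G = sup η + L_σ √β ῡ`, because `σ` is `L_σ`-Lipschitz along segments in `X`
(`posteriorStd_le_add`). The number `ῡ` is the solution of `ζ (sup η + L_σ √β ῡ) = -λ_max ῡ`, so
`‖e(T)‖ ≤ ῡ (1 - exp(λ_max T)) < ῡ`, and the error never reaches the sphere of radius `ῡ`.

The Lipschitz estimate for `σ` combines Cauchy–Schwarz for the posterior covariance, which makes `σ`
1-Lipschitz for the metric `√(2k(0) - 2k(x - y))`, with integration of the gradient of this metric
along a segment. -/

theorem IsStationaryKernel.posSemidef (hk : IsStationaryKernel k) {ι : Type*} [Fintype ι]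
    (z : ι → State d) : (Matrix.of fun i j => k (z i - z j)).PosSemidef := by
  have h := (hk _ (z ∘ (Fintype.equivFin ι).symm)).submatrix (Fintype.equivFin ι)
  convert h using 1
  ext i j
  simp [gram]

theorem IsStationaryKernel.neg (hk : IsStationaryKernel k) (r : State d) : k (-r) = k r := by
  have h := (hk.posSemidef ![r, 0]).1.apply 0 1
  simpa using h

theorem IsStationaryKernel.sub_comm (hk : IsStationaryKernel k) (x y : State d) :
    k (x - y) = k (y - x) := by
  rw [← hk.neg, neg_sub]

theorem IsStationaryKernel.le_zero (hk : IsStationaryKernel k) (r : State d) : k r ≤ k 0 := by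
  have h := (hk.posSemidef ![r, 0]).dotProduct_mulVec_nonneg ![1, -1]
  simp [Matrix.mulVec, dotProduct, Fin.sum_univ_two, hk.neg] at h
  linarith

/-- The regularized kernel matrix `K + σ_on² I`. -/
def regGram (k : State d → ℝ) (s : ℝ) {N : ℕ} (z : Fin N → State d) :
    Matrix (Fin N) (Fin N) ℝ :=
  gram k z + s ^ 2 • (1 : Matrix (Fin N) (Fin N) ℝ)

theorem IsStationaryKernel.regGram_posDef (hk : IsStationaryKernel k) {s : ℝ} (hs : 0 < s) {N : ℕ}
    (z : Fin N → State d) : (regGram k s z).PosDef :=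
  Matrix.PosDef.posSemidef_add (hk N z) (Matrix.PosDef.one.smul (by positivity))

/-- The quadratic form of the posterior covariance at two points dominates the noise part. -/
theorem IsStationaryKernel.posterior_quadratic (hk : IsStationaryKernel k) {s : ℝ} (hs : 0 < s)
    {N : ℕ} (z : Fin N → State d) (x y : State d) (p q : ℝ) (v a : Fin N → ℝ)
    (hv : v = p • kvec k z x + q • kvec k z y) (ha : a = (regGram k s z)⁻¹ *ᵥ v) :
    s ^ 2 * (a ⬝ᵥ a) ≤ (p ^ 2 + q ^ 2) * k 0 + 2 * p * q * k (x - y) - v ⬝ᵥ a := by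
  have hM := hk.regGram_posDef hs z
  have hMa : regGram k s z *ᵥ a = v := by
    rw [ha, Matrix.mulVec_mulVec, Matrix.mul_nonsing_inv _ ((Matrix.isUnit_iff_isUnit_det _).1
      hM.isUnit), Matrix.one_mulVec]
  set B : Matrix (Fin N) (Fin 2) ℝ := Matrix.of fun i j => k (z i - (![x, y] : Fin 2 → State d) j)
  set D : Matrix (Fin 2) (Fin 2) ℝ :=
    Matrix.of fun i j => k ((![x, y] : Fin 2 → State d) i - (![x, y] : Fin 2 → State d) j)
  have hblock : (Matrix.fromBlocks (gram k z) B Bᵀ D).PosSemidef := by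
    convert hk.posSemidef (Sum.elim z ![x, y]) using 1
    ext (i | i) (j | j)
    · simp [gram]
    · simp [B]
    · simp [B, hk.sub_comm]
    · simp [D]
  -- The joint kernel matrix of the data and of `x`, `y` is tested on the Schur complement vector
  -- `(-a, (p, q))`. Since `K a = v - s² a`, the noise leaves the extra term `s² a ⬝ᵥ a`.
  have h := hblock.dotProduct_mulVec_nonneg (Sum.elim (-a) ![p, q])
  have hB : B *ᵥ ![p, q] = v := by
    ext i
    simp [B, hv, Matrix.mulVec, dotProduct, Fin.sum_univ_two, kvec, hk.sub_comm (z i), mul_comm]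
  have hK : gram k z *ᵥ a = v - s ^ 2 • a := by
    rw [← hMa, regGram, Matrix.add_mulVec, Matrix.smul_mulVec, Matrix.one_mulVec]; abel
  have hD : ![p, q] ⬝ᵥ (D *ᵥ ![p, q]) = (p ^ 2 + q ^ 2) * k 0 + 2 * p * q * k (x - y) := by
    simp [D, Matrix.mulVec, dotProduct, Fin.sum_univ_two, hk.sub_comm y x]
    ring
  rw [Matrix.fromBlocks_mulVec] at h
  have hstar : star (Sum.elim (-a) ![p, q]) = Sum.elim (-a) ![p, q] := by
    ext (i | i) <;> simp
  rw [hstar, sumElim_dotProduct_sumElim] at h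
  simp only [Sum.elim_comp_inl, Sum.elim_comp_inr, Matrix.mulVec_neg, hB, hK, dotProduct_add,
    dotProduct_neg, neg_dotProduct, dotProduct_sub, dotProduct_smul, hD, Matrix.mulVec_transpose]
    at h
  rw [dotProduct_comm ![p, q] (a ᵥ* B), ← Matrix.dotProduct_mulVec, hB] at h
  rw [dotProduct_comm v a]
  simp only [smul_eq_mul] at h
  linarith

theorem IsStationaryKernel.dotProduct_inv_nonneg (hk : IsStationaryKernel k) {s : ℝ} (hs : 0 < s)
    {N : ℕ} (z : Fin N → State d) (v : Fin N → ℝ) : 0 ≤ v ⬝ᵥ ((regGram k s z)⁻¹ *ᵥ v) := by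
  simpa using (hk.regGram_posDef hs z).inv.posSemidef.dotProduct_mulVec_nonneg v

theorem posteriorVar_le (hk : IsStationaryKernel k) {s : ℝ} (hs : 0 < s) (D : DataSet d)
    (x : State d) : posteriorVar k s D x ≤ k 0 := by
  have := hk.dotProduct_inv_nonneg hs D.input (kvec k D.input x)
  unfold posteriorVar
  unfold regGram at this
  linarith

/-- The variance dominates `s² ‖a‖²` with `a = (K + s² I)⁻¹ k(x)`, and if `a = 0` it equals `k 0`.
Strict positivity lets one divide by `σ` and makes the tracking bound strictly positive when `ζ >
0`. -/
theorem posteriorVar_pos (hk : IsStationaryKernel k) (hk0 : 0 < k 0) {s : ℝ} (hs : 0 < s)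
    (D : DataSet d) (x : State d) : 0 < posteriorVar k s D x := by
  have h := hk.posterior_quadratic hs D.input x x 1 0 _ _ rfl rfl
  simp only [one_smul, zero_smul, add_zero] at h
  set a := (regGram k s D.input)⁻¹ *ᵥ kvec k D.input x with ha
  change 0 < k 0 - kvec k D.input x ⬝ᵥ a
  by_cases h0 : a = 0
  · simpa [h0] using hk0
  · have : 0 < a ⬝ᵥ a := by
      simpa using (Matrix.dotProduct_star_self_pos_iff (v := a)).2 h0
    have := mul_pos (pow_pos hs 2) this
    linarith

theorem posteriorStd_le (hk : IsStationaryKernel k) {s : ℝ} (hs : 0 < s) (D : DataSet d)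
    (x : State d) : posteriorStd k s D x ≤ √(k 0) :=
  Real.sqrt_le_sqrt (posteriorVar_le hk hs D x)

/-- The posterior standard deviation is `1`-Lipschitz for the kernel metric. -/
theorem abs_posteriorStd_sub_le (hk : IsStationaryKernel k) (hk0 : 0 < k 0) {s : ℝ} (hs : 0 < s)
    (D : DataSet d) (x y : State d) :
    |posteriorStd k s D x - posteriorStd k s D y| ≤ √(2 * k 0 - 2 * k (x - y)) := by
  have hx := posteriorVar_pos hk hk0 hs D x
  have hy := posteriorVar_pos hk hk0 hs D y
  set σx := posteriorStd k s D x with hσx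
  set σy := posteriorStd k s D y with hσy
  have hσx0 : 0 < σx := Real.sqrt_pos.2 hx
  have hσy0 : 0 < σy := Real.sqrt_pos.2 hy
  have hx2 : σx ^ 2 = posteriorVar k s D x := Real.sq_sqrt hx.le
  have hy2 : σy ^ 2 = posteriorVar k s D y := Real.sq_sqrt hy.le
  set u := kvec k D.input x with hu
  set w := kvec k D.input y with hw
  set M := (regGram k s D.input)⁻¹ with hM
  have hMsymm : w ⬝ᵥ (M *ᵥ u) = u ⬝ᵥ (M *ᵥ w) := by
    have h1 : Mᵀ = M := by
      rw [← Matrix.conjTranspose_eq_transpose_of_trivial]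
      exact (hk.regGram_posDef hs D.input).inv.isHermitian.eq
    rw [Matrix.dotProduct_mulVec, dotProduct_comm, ← Matrix.mulVec_transpose, h1]
  have hvx : posteriorVar k s D x = k 0 - u ⬝ᵥ (M *ᵥ u) := rfl
  have hvy : posteriorVar k s D y = k 0 - w ⬝ᵥ (M *ᵥ w) := rfl
  have hexp : ∀ p q : ℝ, (p • u + q • w) ⬝ᵥ (M *ᵥ (p • u + q • w)) =
      p ^ 2 * (u ⬝ᵥ (M *ᵥ u)) + 2 * p * q * (u ⬝ᵥ (M *ᵥ w)) + q ^ 2 * (w ⬝ᵥ (M *ᵥ w)) := by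
    intro p q
    simp only [Matrix.mulVec_add, Matrix.mulVec_smul, dotProduct_add, add_dotProduct,
      dotProduct_smul, smul_dotProduct, smul_eq_mul, hMsymm]
    ring
  -- The weights `σy`, `-σx` are those of the proof of Cauchy–Schwarz: they give posterior
  -- covariance at most `σx σy` (`h4`).
  have h1 := hk.posterior_quadratic hs D.input x y σy (-σx) _ _ rfl rfl
  rw [hexp] at h1
  -- Conditioning removes from `2k(0) - 2k(x - y)` the form of `(K + s² I)⁻¹` at `u - w`, so it can
  -- only shrink the kernel metric.
  have h2 := hk.dotProduct_inv_nonneg hs D.input ((1 : ℝ) • u + (-1 : ℝ) • w)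
  rw [hexp] at h2
  have h3 : ∀ a : Fin D.N → ℝ, 0 ≤ s ^ 2 * (a ⬝ᵥ a) := fun a =>
    mul_nonneg (sq_nonneg s) (by simpa using dotProduct_star_self_nonneg a)
  have h1 := (h3 _).trans h1
  have h4 : k (x - y) - u ⬝ᵥ (M *ᵥ w) ≤ σx * σy := by
    refine le_of_mul_le_mul_left ?_ (mul_pos hσx0 hσy0)
    nlinarith
  apply Real.abs_le_sqrt
  nlinarith

end Kernel

/-! ### Gradient bounds for the kernel and Lipschitz continuity of the posterior deviation. -/

section KernelGradient

variable {d : ℕ} {k : State d → ℝ}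

theorem hasDerivAt_comp_line (hk : Differentiable ℝ k) (x v : State d) (t : ℝ) :
    HasDerivAt (fun t : ℝ => k (x + t • v)) (inner ℝ (gradient k (x + t • v)) v) t := by
  have h1 : HasDerivAt (fun t : ℝ => x + t • v) v t := by
    simpa using ((hasDerivAt_id t).smul_const v).const_add x
  have h2 := (hk (x + t • v)).hasGradientAt.hasFDerivAt.comp_hasDerivAt t h1
  rwa [InnerProductSpace.toDual_apply_apply] at h2

/-- A function bounded above by `C` with `L`-Lipschitz gradient has `‖∇k‖² ≤ 2 L (C - k)`. -/
theorem norm_gradient_sq_le {C : ℝ} {L : ℝ≥0} (hk : Differentiable ℝ k)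
    (hL : LipschitzWith L (gradient k)) (hLpos : 0 < L) (hC : ∀ r, k r ≤ C) (r : State d) :
    ‖gradient k r‖ ^ 2 ≤ 2 * L * (C - k r) := by
  set g := gradient k r with hg
  have hL' : (0 : ℝ) < L := hLpos
  have hline := hasDerivAt_comp_line hk r g
  -- Ascent along the gradient: the lower bound gains most at `t = 1 / L`, where the gain `‖g‖² /
  -- (2L)` cannot exceed `C - k r`.
  have key : ∀ t ∈ Icc (0 : ℝ) (1 / L),
      k r + t * ‖g‖ ^ 2 - L * t ^ 2 / 2 * ‖g‖ ^ 2 ≤ k (r + t • g) := by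
    refine image_le_of_deriv_right_le_deriv_boundary
      (f' := fun t => ‖g‖ ^ 2 - L * t * ‖g‖ ^ 2)
      (B' := fun t => inner ℝ (gradient k (r + t • g)) g) (by fun_prop) ?_ (by simp) ?_ ?_ ?_
    · intro t _
      have : HasDerivAt (fun t : ℝ => k r + t * ‖g‖ ^ 2 - L * t ^ 2 / 2 * ‖g‖ ^ 2)
          (1 * ‖g‖ ^ 2 - L * (2 * t) / 2 * ‖g‖ ^ 2) t := by
        refine (((hasDerivAt_id t).mul_const _).const_add _).sub ?_
        have := (((hasDerivAt_pow 2 t).const_mul (L : ℝ)).div_const 2).mul_const (‖g‖ ^ 2)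
        simpa using this
      refine (this.congr_deriv ?_).hasDerivWithinAt
      ring
    · exact fun t _ => (hline t).continuousAt.continuousWithinAt
    · exact fun t _ => (hline t).hasDerivWithinAt
    · intro t ht
      have h1 : ‖gradient k (r + t • g) - g‖ ≤ L * (t * ‖g‖) := by
        have := hL.dist_le_mul (r + t • g) r
        rwa [dist_eq_norm, dist_eq_norm, add_sub_cancel_left, norm_smul, Real.norm_of_nonneg ht.1]
          at this
      have h2 := (neg_le_abs _).trans (abs_real_inner_le_norm (gradient k (r + t • g) - g) g)
      rw [inner_sub_left, real_inner_self_eq_norm_sq] at h2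
      have h3 := mul_le_mul_of_nonneg_right h1 (norm_nonneg g)
      nlinarith
  have h := (key (1 / L) ⟨by positivity, le_rfl⟩).trans (hC _)
  have : 1 / (L : ℝ) * ‖g‖ ^ 2 - L * (1 / L) ^ 2 / 2 * ‖g‖ ^ 2 = ‖g‖ ^ 2 / (2 * L) := by
    field_simp; ring
  have h' : ‖g‖ ^ 2 / (2 * L) ≤ C - k r := by linarith
  rw [div_le_iff₀ (by positivity)] at h'
  linarith

/-- The inequality `‖∇k‖² ≤ 2 L (k(0) - k)` bounds every quotient by `√L`. Without boundedness,
`sSup` would take its default value `0`. -/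
theorem bddAbove_Lsigma {L : ℝ≥0} (hker : IsStationaryKernel k) (hk : Differentiable ℝ k)
    (hL : LipschitzWith L (gradient k)) (hLpos : 0 < L) (X : Set (State d)) :
    BddAbove {c | ∃ x ∈ X, ∃ x' ∈ X,
      c = √(1 / (2 * k 0 - 2 * k (x - x'))) * ‖gradient k (x - x')‖} := by
  refine ⟨√(L : ℝ), ?_⟩
  rintro c ⟨x, -, x', -, rfl⟩
  have h := norm_gradient_sq_le hk hL hLpos hker.le_zero (x - x')
  have h0 := hker.le_zero (x - x')
  rw [← Real.sqrt_sq (norm_nonneg (gradient k (x - x'))), ← Real.sqrt_mul (by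
    apply one_div_nonneg.2; linarith)]
  apply Real.sqrt_le_sqrt
  rcases h0.lt_or_eq with h0 | h0
  · rw [one_div_mul_eq_div, div_le_iff₀ (by linarith)]
    linarith
  · simp [h0]

theorem Lsigma_nonneg (X : Set (State d)) : 0 ≤ Lsigma k X := by
  apply Real.sSup_nonneg
  rintro c ⟨x, -, x', -, rfl⟩
  positivity

theorem norm_gradient_le_Lsigma_mul {L : ℝ≥0} (hker : IsStationaryKernel k)
    (hk : Differentiable ℝ k) (hL : LipschitzWith L (gradient k)) (hLpos : 0 < L)
    {X : Set (State d)} {x y : State d} (hx : x ∈ X) (hy : y ∈ X) :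
    ‖gradient k (x - y)‖ ≤ Lsigma k X * √(2 * k 0 - 2 * k (x - y)) := by
  have h := norm_gradient_sq_le hk hL hLpos hker.le_zero (x - y)
  rcases (hker.le_zero (x - y)).lt_or_eq with h0 | h0
  · have h1 := le_csSup (bddAbove_Lsigma hker hk hL hLpos X) ⟨x, hx, y, hy, rfl⟩
    change _ ≤ Lsigma k X at h1
    have h2 : 0 < √(2 * k 0 - 2 * k (x - y)) := Real.sqrt_pos.2 (by linarith)
    rw [one_div, Real.sqrt_inv, inv_mul_eq_div, div_le_iff₀ h2] at h1
    exact h1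
  -- Here `k` attains its maximum, so the gradient vanishes and the contribution `0` assigned to
  -- such points loses nothing.
  · rw [h0, sub_self, mul_zero] at h
    have : ‖gradient k (x - y)‖ = 0 := by nlinarith [norm_nonneg (gradient k (x - y))]
    simp [this, h0]

/-- The kernel metric is bounded by `L_σ` times the Euclidean metric along segments in `X`. -/
theorem sqrt_kernel_dist_le {L : ℝ≥0} (hker : IsStationaryKernel k)
    (hk : Differentiable ℝ k) (hL : LipschitzWith L (gradient k)) (hLpos : 0 < L)
    {X : Set (State d)} {x y : State d} (hX : segment ℝ y x ⊆ X) :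
    √(2 * k 0 - 2 * k (x - y)) ≤ Lsigma k X * ‖x - y‖ := by
  set v := x - y with hv
  set φ : ℝ → ℝ := fun t => 2 * k 0 - 2 * k (0 + t • v) with hφ
  have hφ0 : ∀ t, 0 ≤ φ t := fun t => by
    have := hker.le_zero (0 + t • v)
    simp only [hφ]; linarith
  have hseg : ∀ t ∈ Icc (0 : ℝ) 1, y + t • v ∈ X := fun t ht => hX (by
    rw [segment_eq_image']; exact ⟨t, ht, rfl⟩)
  -- The square root is not differentiable where `φ` vanishes, in particular at `t = 0`; adding `η²`
  -- regularizes it, at a cost of `η` in the final bound.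
  apply le_of_forall_pos_le_add
  intro η hη
  have hder : ∀ t, HasDerivAt (fun t => √(φ t + η ^ 2))
      (-(2 * inner ℝ (gradient k (0 + t • v)) v) / (2 * √(φ t + η ^ 2))) t := by
    intro t
    have hpos : φ t + η ^ 2 ≠ 0 := by have := hφ0 t; positivity
    refine HasDerivAt.sqrt ?_ hpos
    exact (((hasDerivAt_comp_line hk 0 v t).const_mul 2).const_sub (2 * k 0)).add_const _
  have key := image_le_of_deriv_right_le_deriv_boundary (a := 0) (b := 1)
    (B := fun t => η + Lsigma k X * ‖v‖ * t) (B' := fun _ => Lsigma k X * ‖v‖)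
    (fun t _ => (hder t).continuousAt.continuousWithinAt)
    (fun t _ => (hder t).hasDerivWithinAt)
    (by simp [hφ, Real.sqrt_sq hη.le]) (by fun_prop)
    (fun t _ => by
      simpa using (((hasDerivAt_id t).const_mul (Lsigma k X * ‖v‖)).const_add η).hasDerivWithinAt)
    (fun t ht => by
      have hpos : 0 < √(φ t + η ^ 2) := Real.sqrt_pos.2 (by have := hφ0 t; positivity)
      have hle : √(φ t) ≤ √(φ t + η ^ 2) := Real.sqrt_le_sqrt (by nlinarith)
      have h1 := norm_gradient_le_Lsigma_mul hker hk hL hLpos (hseg t ⟨ht.1, ht.2.le⟩)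
        (hX (left_mem_segment ℝ y x))
      rw [add_sub_cancel_left] at h1
      rw [zero_add, div_le_iff₀ (by positivity)]
      have h2 := (neg_le_abs _).trans (abs_real_inner_le_norm (gradient k (t • v)) v)
      have h3 : ‖gradient k (t • v)‖ ≤ Lsigma k X * √(φ t + η ^ 2) := by
        refine h1.trans (mul_le_mul_of_nonneg_left ?_ (Lsigma_nonneg X))
        simpa [hφ] using hle
      have h4 := mul_le_mul_of_nonneg_right h3 (norm_nonneg v)
      linarith)
    (right_mem_Icc.2 zero_le_one)
  have h5 : √(2 * k 0 - 2 * k v) ≤ √(φ 1 + η ^ 2) := Real.sqrt_le_sqrt (by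
    simp only [hφ, one_smul, zero_add]; nlinarith)
  linarith

theorem posteriorStd_le_add {L : ℝ≥0} (hker : IsStationaryKernel k) (hk0 : 0 < k 0)
    (hk : Differentiable ℝ k) (hL : LipschitzWith L (gradient k)) (hLpos : 0 < L) {s : ℝ}
    (hs : 0 < s) (D : DataSet d) {X : Set (State d)} {x y : State d} (hX : segment ℝ y x ⊆ X) :
    posteriorStd k s D x ≤ posteriorStd k s D y + Lsigma k X * ‖x - y‖ := by
  have h := ((le_abs_self _).trans (abs_posteriorStd_sub_le hker hk0 hs D x y)).trans
    (sqrt_kernel_dist_le hker hk hL hLpos hX)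
  linarith

end KernelGradient

/-! ### Forced stable linear equations and the first-exit argument. -/

section LinearComparison

/-- Variation of constants estimate for a scalar stable equation with bounded forcing. -/
theorem norm_le_of_scalar_forced {z : ℝ → ℂ} {l c : ℂ} {g : ℝ → ℝ} {lam G T : ℝ} (hT : 0 ≤ T)
    (hl : l.re ≤ lam) (hlam : lam < 0) (hz0 : z 0 = 0)
    (hz : ∀ t, 0 ≤ t → HasDerivWithinAt z (l * z t + g t * c) (Ici 0) t)
    (hg : ∀ t ∈ Ico 0 T, |g t| ≤ G) :
    ‖z T‖ ≤ G * ((1 - Real.exp (lam * T)) / -lam) * ‖c‖ := by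
  -- Integrating factor normalized to `1` at `t = T`: the product with `z` ends at `z T`, and its
  -- derivative retains only the forcing.
  have hE : ∀ t : ℝ, HasDerivAt (fun t : ℝ => Complex.exp (l * ((T - t : ℝ) : ℂ)))
      (Complex.exp (l * ((T - t : ℝ) : ℂ)) * -l) t := by
    intro t
    have h1 : HasDerivAt (fun t : ℝ => ((T - t : ℝ) : ℂ)) ((-1 : ℝ) : ℂ) t :=
      ((hasDerivAt_id t).const_sub T).ofReal_comp
    have h2 := (h1.const_mul l).cexp
    simpa using h2
  have hB : ∀ t : ℝ, HasDerivAt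
      (fun t => G * ((Real.exp (lam * (T - t)) - Real.exp (lam * T)) / -lam) * ‖c‖)
      (G * Real.exp (lam * (T - t)) * ‖c‖) t := by
    intro t
    have h1 : HasDerivAt (fun t => Real.exp (lam * (T - t)))
        (Real.exp (lam * (T - t)) * (lam * -1)) t :=
      (((hasDerivAt_id t).const_sub T).const_mul lam).exp
    refine ((((h1.sub_const _).div_const (-lam)).const_mul G).mul_const ‖c‖).congr_deriv ?_
    have := hlam.ne
    field_simp
  have hu : ∀ t, 0 ≤ t → HasDerivWithinAt (fun t => Complex.exp (l * ((T - t : ℝ) : ℂ)) * z t)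
      (Complex.exp (l * ((T - t : ℝ) : ℂ)) * (g t * c)) (Ici 0) t := by
    intro t ht
    refine ((hE t).hasDerivWithinAt.mul (hz t ht)).congr_deriv ?_
    ring
  have key := image_norm_le_of_norm_deriv_right_le_deriv_boundary (a := 0) (b := T)
    (fun t ht => (hu t ht.1).continuousWithinAt.mono Icc_subset_Ici_self)
    (fun t ht => (hu t ht.1).mono (Ici_subset_Ici.2 ht.1))
    (B := fun t => G * ((Real.exp (lam * (T - t)) - Real.exp (lam * T)) / -lam) * ‖c‖)
    (by simp [hz0]) hB
    (fun t ht => by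
      rw [norm_mul, norm_mul, Complex.norm_exp, Complex.norm_real, Real.norm_eq_abs]
      have h1 : Real.exp (l * ((T - t : ℝ) : ℂ)).re ≤ Real.exp (lam * (T - t)) := by
        rw [Complex.re_mul_ofReal]
        exact Real.exp_le_exp.2 (mul_le_mul_of_nonneg_right hl (by linarith [ht.2]))
      have h2 := hg t ht
      calc _ ≤ Real.exp (lam * (T - t)) * (G * ‖c‖) := by gcongr
        _ = _ := by ring)
    (right_mem_Icc.2 hT)
  simpa using key

variable {d : ℕ}

/-- A real vector, regarded as a complex one. -/
def complexVec (v : State d) : Fin d → ℂ := fun i => (v i : ℂ)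

theorem norm_toLp_complexVec (v : State d) :
    ‖(WithLp.toLp 2 (complexVec v) : EuclideanSpace ℂ (Fin d))‖ = ‖v‖ := by
  simp [EuclideanSpace.norm_eq, complexVec]

theorem complexVec_mulVec (B : Matrix (Fin d) (Fin d) ℝ) (v : State d) :
    complexVec (WithLp.toLp 2 (B *ᵥ fun i => v i)) = complexify B *ᵥ complexVec v := by
  ext i
  simp [complexVec, complexify, Matrix.mulVec, dotProduct]

theorem spectrum_of_isEigendecomposition {B : Matrix (Fin d) (Fin d) ℝ}
    {U : Matrix (Fin d) (Fin d) ℂ} (hU : IsUnit U.det) {Λ : Fin d → ℂ}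
    (h : complexify B = U * Matrix.diagonal Λ * U⁻¹) :
    spectrum ℂ (complexify B) = range Λ := by
  have hu := (Matrix.isUnit_iff_isUnit_det U).2 hU
  obtain ⟨u, rfl⟩ := hu
  rw [h, ← Matrix.coe_units_inv, spectrum.units_conjugate, spectrum_diagonal]

theorem re_le_lambdaMax {B : Matrix (Fin d) (Fin d) ℝ}
    {U : Matrix (Fin d) (Fin d) ℂ} (hU : IsUnit U.det) {Λ : Fin d → ℂ}
    (h : complexify B = U * Matrix.diagonal Λ * U⁻¹) (j : Fin d) : (Λ j).re ≤ lambdaMax B := by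
  have hs := spectrum_of_isEigendecomposition hU h
  apply le_csSup
  · rw [hs]
    exact ((finite_range Λ).image _).bddAbove
  · rw [hs]
    exact ⟨Λ j, ⟨j, rfl⟩, rfl⟩

/-- In the coordinates `U⁻¹ e` the system decouples into scalar equations with forcing `g` times the
entries of `U⁻¹ b`. The same factor bounds every coordinate, so it passes to the Euclidean norm, and
multiplying back by `U` produces `ζ`. -/
theorem norm_le_of_forced {B : Matrix (Fin d) (Fin d) ℝ} {b : State d}
    {U : Matrix (Fin d) (Fin d) ℂ} (hU : IsEigendecomposition B U) {e : ℝ → State d}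
    {g : ℝ → ℝ} {G T : ℝ} (hT : 0 ≤ T) (hlam : lambdaMax B < 0) (he0 : e 0 = 0)
    (he : ∀ t, 0 ≤ t → HasDerivWithinAt e
      (WithLp.toLp 2 (B *ᵥ fun i => e t i) + g t • b) (Ici 0) t)
    (hG : 0 ≤ G) (hg : ∀ t ∈ Ico 0 T, |g t| ≤ G) :
    ‖e T‖ ≤ zeta U b * (G * ((1 - Real.exp (lambdaMax B * T)) / -lambdaMax B)) := by
  obtain ⟨hdet, Λ, hΛ⟩ := hU
  set κ := G * ((1 - Real.exp (lambdaMax B * T)) / -lambdaMax B) with hκ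
  have hκ0 : 0 ≤ κ := by
    refine mul_nonneg hG (div_nonneg ?_ (by linarith))
    rw [sub_nonneg, Real.exp_le_one_iff]
    exact mul_nonpos_of_nonpos_of_nonneg hlam.le hT
  set c : Fin d → ℂ := U⁻¹ *ᵥ fun i => (b i : ℂ) with hc
  have hcomp : ∀ j, ‖(U⁻¹ *ᵥ complexVec (e T)) j‖ ≤ κ * ‖c j‖ := by
    intro j
    refine norm_le_of_scalar_forced (z := fun t => (U⁻¹ *ᵥ complexVec (e t)) j) (g := g) hT
      (re_le_lambdaMax hdet hΛ j) hlam ?_ ?_ hg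
    · simp [he0, complexVec, Matrix.mulVec, dotProduct]
    · intro t ht
      have h1 : ∀ i, HasDerivWithinAt (fun t => complexVec (e t) i)
          (complexVec (WithLp.toLp 2 (B *ᵥ fun i => e t i) + g t • b) i) (Ici 0) t := by
        intro i
        have := (EuclideanSpace.proj (𝕜 := ℝ) i : State d →L[ℝ] ℝ).hasFDerivAt
          |>.comp_hasDerivWithinAt t (he t ht)
        exact HasDerivWithinAt.ofReal_comp this
      have h2 : HasDerivWithinAt (fun t => (U⁻¹ *ᵥ complexVec (e t)) j)
          ((U⁻¹ *ᵥ complexVec (WithLp.toLp 2 (B *ᵥ fun i => e t i) + g t • b)) j) (Ici 0) t :=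
        HasDerivWithinAt.fun_sum (u := Finset.univ) fun i _ => (h1 i).const_mul (U⁻¹ j i)
      refine h2.congr_deriv ?_
      have h3 : complexVec (WithLp.toLp 2 (B *ᵥ fun i => e t i) + g t • b) =
          complexify B *ᵥ complexVec (e t) + (g t : ℂ) • fun i => (b i : ℂ) := by
        rw [← complexVec_mulVec]
        ext i
        simp [complexVec]
      rw [h3, hΛ, Matrix.mulVec_add, Matrix.mulVec_smul, Matrix.mulVec_mulVec, ← mul_assoc,
        ← mul_assoc, Matrix.nonsing_inv_mul _ hdet, one_mul, ← Matrix.mulVec_mulVec, Pi.add_apply, Matrix.mulVec_diagonal]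
      simp [hc]
  have hz : ‖(WithLp.toLp 2 (U⁻¹ *ᵥ complexVec (e T)) : EuclideanSpace ℂ (Fin d))‖ ≤
      κ * ‖(WithLp.toLp 2 c : EuclideanSpace ℂ (Fin d))‖ := by
    rw [← Real.norm_of_nonneg hκ0, ← Complex.norm_real, ← norm_smul, EuclideanSpace.norm_eq,
      EuclideanSpace.norm_eq]
    apply Real.sqrt_le_sqrt
    refine Finset.sum_le_sum fun j _ => ?_
    gcongr
    simpa [abs_of_nonneg hκ0] using hcomp j
  have hUz : (WithLp.toLp 2 (complexVec (e T)) : EuclideanSpace ℂ (Fin d)) =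
      Matrix.toEuclideanCLM (n := Fin d) (𝕜 := ℂ) U (WithLp.toLp 2 (U⁻¹ *ᵥ complexVec (e T))) := by
    rw [Matrix.toEuclideanCLM_toLp, Matrix.mulVec_mulVec, Matrix.mul_nonsing_inv _ hdet,
      Matrix.one_mulVec]
  rw [← norm_toLp_complexVec, hUz]
  refine (ContinuousLinearMap.le_opNorm _ _).trans ?_
  refine (mul_le_mul_of_nonneg_left hz (norm_nonneg _)).trans_eq ?_
  rw [zeta]
  ring

theorem zeta_nonneg (U : Matrix (Fin d) (Fin d) ℂ) (b : State d) : 0 ≤ zeta U b := by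
  unfold zeta
  positivity

/-- From `b = U (U⁻¹ b)` one gets `‖b‖ ≤ ζ`. -/
theorem eq_zero_of_zeta_eq_zero {U : Matrix (Fin d) (Fin d) ℂ} (hU : IsUnit U.det) {b : State d}
    (h : zeta U b = 0) : b = 0 := by
  rw [← norm_eq_zero, ← norm_toLp_complexVec]
  have hUz : (WithLp.toLp 2 (complexVec b) : EuclideanSpace ℂ (Fin d)) =
      Matrix.toEuclideanCLM (n := Fin d) (𝕜 := ℂ) U (WithLp.toLp 2 (U⁻¹ *ᵥ complexVec b)) := by
    rw [Matrix.toEuclideanCLM_toLp, Matrix.mulVec_mulVec, Matrix.mul_nonsing_inv _ hU,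
      Matrix.one_mulVec]
  rw [hUz]
  exact le_antisymm ((ContinuousLinearMap.le_opNorm _ _).trans_eq h) (norm_nonneg _)

/-- The zero solution of a homogeneous linear equation is unique. -/
theorem eq_zero_of_linear {B : Matrix (Fin d) (Fin d) ℝ} {e : ℝ → State d} (he0 : e 0 = 0)
    (he : ∀ t, 0 ≤ t → HasDerivWithinAt e (WithLp.toLp 2 (B *ᵥ fun i => e t i)) (Ici 0) t)
    {t : ℝ} (ht : 0 ≤ t) : e t = 0 := by
  refine eq_zero_of_abs_deriv_le_mul_abs_self_of_eq_zero_right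
    (K := ‖Matrix.toEuclideanCLM (n := Fin d) (𝕜 := ℝ) B‖) (a := 0) (b := t)
    (fun s hs => (he s hs.1).continuousWithinAt.mono Icc_subset_Ici_self)
    (fun s hs => (he s hs.1).mono (Ici_subset_Ici.2 hs.1)) he0 (fun s _ => ?_) t
    (right_mem_Icc.2 ht)
  have := (Matrix.toEuclideanCLM (n := Fin d) (𝕜 := ℝ) B).le_opNorm (e s)
  exact this

/-- A continuous curve that starts at `0` and cannot reach the sphere of radius `v` before leaving
the open ball stays in the ball. -/
theorem norm_lt_of_no_first_exit {E : Type*} [NormedAddCommGroup E] {e : ℝ → E} {v : ℝ}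
    (he : ContinuousOn e (Ici 0))
    (hstep : ∀ T, 0 ≤ T → (∀ t ∈ Ico 0 T, ‖e t‖ < v) → ‖e T‖ < v) {t : ℝ} (ht : 0 ≤ t) :
    ‖e t‖ < v := by
  by_contra! hcon
  set S : Set ℝ := Icc 0 t ∩ (fun s => ‖e s‖) ⁻¹' Ici v with hS
  have hclosed : IsClosed S :=
    (he.norm.mono Icc_subset_Ici_self).preimage_isClosed_of_isClosed isClosed_Icc isClosed_Ici
  have hne : S.Nonempty := ⟨t, right_mem_Icc.2 ht, hcon⟩
  have hbdd : BddBelow S := ⟨0, fun s hs => hs.1.1⟩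
  have hmem := hclosed.csInf_mem hne hbdd
  refine (hstep _ hmem.1.1 fun s hs => ?_).not_ge hmem.2
  by_contra! h
  exact (csInf_le hbdd ⟨⟨hs.1, hs.2.le.trans hmem.1.2⟩, h⟩).not_gt hs.2

end LinearComparison

/-! ### Decay of the bounds, termination and tracking for one realization. -/

section Algorithm

variable {d : ℕ}

/-- A nonempty compact set has a finite covering number `M ≥ 1`, so `M / δ > 1`. Finiteness matters
because `toNat` sends `⊤` to `0`. -/
theorem beta_pos {X : Set (State d)} (hX : IsCompact X) (hne : X.Nonempty) {δ : ℝ}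
    (hδ : δ ∈ Ioo (0 : ℝ) 1) {τ : ℝ≥0} (hτ : 0 < τ) : 0 < beta X δ τ := by
  have hpos : 0 < Metric.externalCoveringNumber τ X :=
    Metric.externalCoveringNumber_pos_iff.2 hne
  have hfin : Metric.externalCoveringNumber τ X ≠ ⊤ := by
    obtain ⟨C, -, hC, hcov⟩ := Metric.exists_finite_isCover_of_isCompact hτ.ne' hX
    exact (hcov.externalCoveringNumber_le_encard.trans_lt hC.encard_lt_top).ne
  have h1 : 1 ≤ (Metric.externalCoveringNumber τ X).toNat := by
    rw [Nat.one_le_iff_ne_zero, Ne, ENat.toNat_eq_zero]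
    exact not_or.2 ⟨hpos.ne', hfin⟩
  have h2 : (1 : ℝ) ≤ (Metric.externalCoveringNumber τ X).toNat := by exact_mod_cast h1
  unfold beta
  refine mul_pos two_pos (Real.log_pos ?_)
  rw [lt_div_iff₀ hδ.1]
  linarith [hδ.2]

variable {p : Problem d} {f : State d → ℝ} {ε : ℕ → ℕ → ℝ} {R : Run d}

theorem Run.Follows.sqrtBeta_pos (hR : R.Follows p f ε) (hp : p.Valid) {i : ℕ}
    (hi : R.Active p f ε i) : 0 < R.sqrtBeta p i :=
  Real.sqrt_pos.2 (beta_pos hp.compact ⟨_, hp.reference_mem 0 le_rfl⟩ hp.δ_mem (hR.tau_pos i hi))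

theorem gamma_nonneg (k : State d → ℝ) (X : Set (State d)) (δ : ℝ) (Lmu Lf τ : ℝ≥0) :
    0 ≤ gamma k X δ Lmu Lf τ := by
  have := Lsigma_nonneg (k := k) X
  unfold gamma
  positivity

theorem Run.std_nonneg (i : ℕ) (x : State d) : 0 ≤ R.std p f ε i x :=
  Real.sqrt_nonneg _

theorem Run.eta_eq (i : ℕ) (x : State d) : R.eta p f ε i x =
    R.sqrtBeta p i * R.std p f ε i x + gamma p.k p.X p.δ (R.Lmu i) R.Lf (R.τ i) := rfl

theorem Run.eta_nonneg (i : ℕ) (x : State d) : 0 ≤ R.eta p f ε i x := by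
  rw [R.eta_eq]
  exact add_nonneg (mul_nonneg (Real.sqrt_nonneg _) (R.std_nonneg i x)) (gamma_nonneg ..)

theorem Run.eta_pos (hp : p.Valid) {i : ℕ} (hβ : 0 < R.sqrtBeta p i) (x : State d) :
    0 < R.eta p f ε i x := by
  rw [R.eta_eq]
  refine add_pos_of_pos_of_nonneg (mul_pos hβ (Real.sqrt_pos.2 ?_)) (gamma_nonneg ..)
  exact posteriorVar_pos hp.kernel hp.kernel_zero_pos hp.son_pos _ x

theorem Run.bddAbove_std (hp : p.Valid) (i : ℕ) :
    BddAbove (range fun t : Ici (0 : ℝ) => R.std p f ε i (p.xref t)) :=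
  ⟨√(p.k 0), by
    rintro _ ⟨t, rfl⟩
    exact posteriorStd_le hp.kernel hp.son_pos _ _⟩

theorem Run.bddAbove_eta (hp : p.Valid) (i : ℕ) :
    BddAbove (range fun t : Ici (0 : ℝ) => R.eta p f ε i (p.xref t)) := by
  obtain ⟨C, hC⟩ := R.bddAbove_std (f := f) (ε := ε) hp i
  refine ⟨R.sqrtBeta p i * C + gamma p.k p.X p.δ (R.Lmu i) R.Lf (R.τ i), ?_⟩
  rintro _ ⟨t, rfl⟩
  change R.eta p f ε i (p.xref t) ≤ _
  rw [R.eta_eq]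
  gcongr
  · exact Real.sqrt_nonneg _
  · exact hC ⟨t, rfl⟩

theorem Run.iSup_eta_nonneg (i : ℕ) :
    0 ≤ ⨆ t : Ici (0 : ℝ), R.eta p f ε i (p.xref t) :=
  Real.iSup_nonneg fun _ => R.eta_nonneg i _

/-- The condition on `τ` reads `γ ≤ √β sup σ`, so the discretization term at most doubles the
leading term. -/
theorem Run.iSup_eta_le (hp : p.Valid) (hR : R.Follows p f ε) {i : ℕ} (hi : R.Active p f ε i) :
    ⨆ t : Ici (0 : ℝ), R.eta p f ε i (p.xref t) ≤
      2 * R.sqrtBeta p i * ⨆ t : Ici (0 : ℝ), R.std p f ε i (p.xref t) := by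
  have hβ := hR.sqrtBeta_pos hp hi
  have hγ := hR.tau_cond i hi
  rw [div_le_iff₀ hβ] at hγ
  refine ciSup_le fun t => ?_
  rw [R.eta_eq]
  have := mul_le_mul_of_nonneg_left (le_ciSup (R.bddAbove_std (f := f) (ε := ε) hp i) t) hβ.le
  linarith

/-- The denominator of the tracking error bound under the eigenvalue condition. -/
theorem Run.GainCond.le_denominator (hp : p.Valid) {i : ℕ} (h : R.GainCond p i) :
    8 * √(p.Ldk : ℝ) * (zeta (R.U i) p.b * R.sqrtBeta p i) ≤
      p.ξ * -(R.lam p i + Lsigma p.k p.X * zeta (R.U i) p.b * R.sqrtBeta p i) := by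
  have h1 := mul_le_mul_of_nonneg_left h hp.ξ_mem.1.le
  have hξ := hp.ξ_mem.1.ne'
  have h2 : p.ξ * ((8 * √(p.Ldk : ℝ) + p.ξ * Lsigma p.k p.X) / p.ξ * zeta (R.U i) p.b *
      R.sqrtBeta p i) = (8 * √(p.Ldk : ℝ) + p.ξ * Lsigma p.k p.X) * zeta (R.U i) p.b *
      R.sqrtBeta p i := by
    field_simp
  rw [h2] at h1
  linarith

theorem Run.GainCond.denominator_pos (hp : p.Valid) {i : ℕ} (h : R.GainCond p i)
    (hβ : 0 < R.sqrtBeta p i) (hζ : 0 < zeta (R.U i) p.b) :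
    0 < -(R.lam p i + Lsigma p.k p.X * zeta (R.U i) p.b * R.sqrtBeta p i) := by
  have hL : 0 < √(p.Ldk : ℝ) := Real.sqrt_pos.2 hp.Ldk_pos
  exact pos_of_mul_pos_right (lt_of_lt_of_le (by positivity) (h.le_denominator hp))
    hp.ξ_mem.1.le

theorem Run.bound_eq (i : ℕ) : R.bound p f ε i = zeta (R.U i) p.b /
    -(R.lam p i + Lsigma p.k p.X * zeta (R.U i) p.b * R.sqrtBeta p i) *
      ⨆ t : Ici (0 : ℝ), R.eta p f ε i (p.xref t) := by
  rw [Run.bound, div_neg]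

/-- Under the eigenvalue condition the tracking error bound is at most
`ξ / (4 √L_∂k)` times the largest posterior standard deviation along the reference. -/
theorem Run.bound_le (hp : p.Valid) (hR : R.Follows p f ε) {i : ℕ} (hi : R.Active p f ε i)
    (h : R.GainCond p i) :
    4 * √(p.Ldk : ℝ) * R.bound p f ε i ≤
      p.ξ * ⨆ t : Ici (0 : ℝ), R.std p f ε i (p.xref t) := by
  have hs : 0 ≤ ⨆ t : Ici (0 : ℝ), R.std p f ε i (p.xref t) :=
    Real.iSup_nonneg fun _ => R.std_nonneg i _
  have hξ := hp.ξ_mem.1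
  have hβ := hR.sqrtBeta_pos hp hi
  -- For `ζ = 0` the denominator need not be positive, but the bound is then `0` whatever its value.
  rcases (zeta_nonneg (R.U i) p.b).eq_or_lt with hζ | hζ
  · rw [R.bound_eq, ← hζ]
    simp only [zero_div, zero_mul, mul_zero]
    positivity
  · have hD := h.denominator_pos hp hβ hζ
    have hle := h.le_denominator hp
    have hη := R.iSup_eta_le hp hR hi
    rw [R.bound_eq, div_mul_eq_mul_div, mul_div_assoc', div_le_iff₀ hD]
    calc 4 * √(p.Ldk : ℝ) * (zeta (R.U i) p.b * ⨆ t : Ici (0 : ℝ), R.eta p f ε i (p.xref t))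
        ≤ 4 * √(p.Ldk : ℝ) * (zeta (R.U i) p.b *
          (2 * R.sqrtBeta p i * ⨆ t : Ici (0 : ℝ), R.std p f ε i (p.xref t))) := by gcongr
      _ = 8 * √(p.Ldk : ℝ) * (zeta (R.U i) p.b * R.sqrtBeta p i) *
          ⨆ t : Ici (0 : ℝ), R.std p f ε i (p.xref t) := by ring
      _ ≤ _ := mul_le_mul_of_nonneg_right hle hs
      _ = _ := by ring

theorem Run.bound_zero_le (hp : p.Valid) (hR : R.Follows p f ε) (h : R.GainCond p 0) :
    4 * √(p.Ldk : ℝ) * R.bound p f ε 0 ≤ p.ξ * √(p.k 0) :=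
  (R.bound_le hp hR (fun _ hj => absurd hj (Nat.not_lt_zero _)) h).trans
    (mul_le_mul_of_nonneg_left
      (ciSup_le fun _ => posteriorStd_le hp.kernel hp.son_pos _ _) hp.ξ_mem.1.le)

theorem Run.bound_succ_le (hp : p.Valid) (hR : R.Follows p f ε) {i : ℕ}
    (hi : R.Active p f ε (i + 1)) (h : R.GainCond p (i + 1))
    (hs : R.SamplingCond p f ε (i + 1)) :
    R.bound p f ε (i + 1) ≤ p.ξ * R.bound p f ε i := by
  -- Positivity comes from the loop not having stopped at model `i`; it is needed to take the root
  -- of `16 L_∂k ῡ_i²`.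
  have hv : 0 < R.bound p f ε i := hp.ebar_pos.trans (hi i i.lt_succ_self)
  have hL : 0 < √(p.Ldk : ℝ) := Real.sqrt_pos.2 hp.Ldk_pos
  have hstd : ⨆ t : Ici (0 : ℝ), R.std p f ε (i + 1) (p.xref t) ≤
      4 * √(p.Ldk : ℝ) * R.bound p f ε i := by
    refine ciSup_le fun t => ?_
    -- The variance condition covers `[0, T_p]` only; every later reference point is already visited
    -- there.
    obtain ⟨s, hs', hst⟩ := hp.reference_episode t t.2
    rw [← hst]
    refine Real.sqrt_le_iff.2 ⟨by positivity, (hs s hs').trans_eq ?_⟩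
    rw [mul_pow, mul_pow, Real.sq_sqrt p.Ldk.coe_nonneg, Nat.add_sub_cancel]
    ring
  have := (R.bound_le hp hR hi h).trans (mul_le_mul_of_nonneg_left hstd hp.ξ_mem.1.le)
  refine le_of_mul_le_mul_left (this.trans_eq ?_) (show 0 < 4 * √(p.Ldk : ℝ) by positivity)
  ring

/-- Taking logarithms, the ceiling already gives this with exponent `N_E`; the additional factor `ξ
< 1`, inherited from the bound on `ῡ_0`, is slack. -/
theorem Problem.pow_maxEpisodes_le (hp : p.Valid) :
    p.ξ ^ (p.maxEpisodes + 1) * √(p.k 0) ≤ 4 * p.ebar * √(p.Ldk : ℝ) := by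
  have hL : 0 < √(p.Ldk : ℝ) := Real.sqrt_pos.2 hp.Ldk_pos
  have hk : 0 < √(p.k 0) := Real.sqrt_pos.2 hp.kernel_zero_pos
  have he := hp.ebar_pos
  have hξ := hp.ξ_mem.1
  have hlog : Real.log p.ξ < 0 := Real.log_neg hξ hp.ξ_mem.2
  have h1 := Nat.le_ceil
    ((Real.log (4 * p.ebar * √(p.Ldk : ℝ)) - Real.log (√(p.k 0))) / Real.log p.ξ)
  change _ ≤ ((p.maxEpisodes : ℕ) : ℝ) at h1
  rw [div_le_iff_of_neg hlog] at h1
  rw [← Real.log_le_log_iff (by positivity) (by positivity),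
    Real.log_mul (by positivity) hk.ne', Real.log_pow]
  push_cast
  linarith

/-- Deterministic core: if both conditions hold in every performed episode, the algorithm
terminates with geometrically decaying bounds. -/
theorem Run.exists_terminatesAfter (hp : p.Valid) (hR : R.Follows p f ε) (h0 : R.GainCond p 0)
    (h : ∀ i, 1 ≤ i → i ≤ p.maxEpisodes → R.Active p f ε i →
      R.GainCond p i ∧ R.SamplingCond p f ε i) :
    ∃ n ≤ p.maxEpisodes, R.TerminatesAfter p f ε n ∧
      ∀ i ≤ n, R.bound p f ε i ≤ p.ξ ^ i * R.bound p f ε 0 := by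
  have hξ := hp.ξ_mem.1
  have hdecay : ∀ i ≤ p.maxEpisodes, R.Active p f ε i →
      R.bound p f ε i ≤ p.ξ ^ i * R.bound p f ε 0 := by
    intro i
    induction i with
    | zero => simp
    | succ i ih =>
      intro hi ha
      obtain ⟨hg, hs⟩ := h (i + 1) (by omega) hi ha
      have h1 := ih (by omega) fun j hj => ha j (hj.trans i.lt_succ_self)
      calc _ ≤ p.ξ * R.bound p f ε i := R.bound_succ_le hp hR ha hg hs
        _ ≤ p.ξ * (p.ξ ^ i * R.bound p f ε 0) := by gcongr
        _ = _ := by ring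
  have hex : ∃ n, n ≤ p.maxEpisodes ∧ R.bound p f ε n ≤ p.ebar := by
    by_contra! hcon
    have ha : R.Active p f ε p.maxEpisodes := fun j hj => hcon j hj.le
    refine (hcon _ le_rfl).not_ge ?_
    have hL : 0 < 4 * √(p.Ldk : ℝ) := mul_pos four_pos (Real.sqrt_pos.2 hp.Ldk_pos)
    refine le_of_mul_le_mul_left ?_ hL
    calc 4 * √(p.Ldk : ℝ) * R.bound p f ε p.maxEpisodes
        ≤ 4 * √(p.Ldk : ℝ) * (p.ξ ^ p.maxEpisodes * R.bound p f ε 0) := by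
          gcongr
          exact hdecay _ le_rfl ha
      _ = p.ξ ^ p.maxEpisodes * (4 * √(p.Ldk : ℝ) * R.bound p f ε 0) := by ring
      _ ≤ p.ξ ^ p.maxEpisodes * (p.ξ * √(p.k 0)) :=
          mul_le_mul_of_nonneg_left (R.bound_zero_le hp hR h0) (pow_nonneg hξ.le _)
      _ = p.ξ ^ (p.maxEpisodes + 1) * √(p.k 0) := by ring
      _ ≤ 4 * p.ebar * √(p.Ldk : ℝ) := Problem.pow_maxEpisodes_le hp
      _ = _ := by ring
  classical
  have hact : R.Active p f ε (Nat.find hex) := fun j hj => by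
    have := Nat.find_min hex hj
    rw [not_and, not_le] at this
    exact this (hj.le.trans (Nat.find_spec hex).1)
  refine ⟨Nat.find hex, (Nat.find_spec hex).1, ⟨hact, (Nat.find_spec hex).2⟩, fun i hi => ?_⟩
  exact hdecay i (hi.trans (Nat.find_spec hex).1) fun j hj => hact j (hj.trans_le hi)

theorem Run.Follows.hasDerivWithinAt_error (hR : R.Follows p f ε) (hp : p.Valid) {i : ℕ}
    (hi : R.Active p f ε i) {t : ℝ} (ht : 0 ≤ t) :
    HasDerivWithinAt (fun t => R.x i t - p.xref t)
      (WithLp.toLp 2 (closedLoop p.A p.b (R.θ i) *ᵥ fun j => (R.x i t - p.xref t) j) +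
        (f (R.x i t) - R.mean p f ε i (R.x i t)) • p.b) (Ici 0) t := by
  refine ((hR.dynamics i hi t ht).sub (hp.reference t ht)).congr_deriv ?_
  have hsub : (fun j => (R.x i t - p.xref t) j) = (fun j => R.x i t j) - fun j => p.xref t j := rfl
  have hθ : (fun j => R.θ i j) ⬝ᵥ (fun j => (R.x i t - p.xref t) j) =
      inner ℝ (R.θ i) (R.x i t - p.xref t) := by
    simp [PiLp.inner_apply, dotProduct, mul_comm]
  ext j
  simp only [closedLoop, Matrix.sub_mulVec, Matrix.vecMulVec_mulVec, hθ, Run.control]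
  rw [hsub, Matrix.mulVec_sub]
  simp
  ring

/-- Along the trajectory the learning error is controlled by the tracking error. -/
theorem Run.ModelValid.abs_error_le (hp : p.Valid) {i : ℕ} (hM : R.ModelValid p f ε i) {t : ℝ}
    (ht : 0 ≤ t) {x : State d} (hx : ‖x - p.xref t‖ ≤ R.bound p f ε i) :
    |f x - R.mean p f ε i x| ≤ (⨆ t : Ici (0 : ℝ), R.eta p f ε i (p.xref t)) +
      Lsigma p.k p.X * R.sqrtBeta p i * R.bound p f ε i := by
  have hball := hM.2 t ht
  have hxb : x ∈ Metric.closedBall (p.xref t) (R.bound p f ε i) := by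
    rwa [mem_closedBall_iff_norm]
  -- The set `X` need not be convex; the segment lies in it because the ball does.
  have hseg : segment ℝ (p.xref t) x ⊆ p.X :=
    ((convex_closedBall _ _).segment_subset
      (Metric.mem_closedBall_self ((norm_nonneg _).trans hx)) hxb).trans hball
  have h1 : R.std p f ε i x ≤ R.std p f ε i (p.xref t) + Lsigma p.k p.X * ‖x - p.xref t‖ :=
    posteriorStd_le_add hp.kernel hp.kernel_zero_pos hp.kernel_differentiable
      hp.kernel_deriv_lipschitz hp.Ldk_pos hp.son_pos _ hseg
  have h2 := le_ciSup (R.bddAbove_eta (f := f) (ε := ε) hp i) ⟨t, ht⟩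
  have hβ : 0 ≤ R.sqrtBeta p i := Real.sqrt_nonneg _
  have hLσ := Lsigma_nonneg (k := p.k) p.X
  calc |f x - R.mean p f ε i x| ≤ R.eta p f ε i x := hM.1 x (hball hxb)
    _ ≤ R.sqrtBeta p i * (R.std p f ε i (p.xref t) + Lsigma p.k p.X * R.bound p f ε i) +
        gamma p.k p.X p.δ (R.Lmu i) R.Lf (R.τ i) := by
      rw [R.eta_eq]
      gcongr
      exact h1.trans (by gcongr)
    _ = R.eta p f ε i (p.xref t) + Lsigma p.k p.X * R.sqrtBeta p i * R.bound p f ε i := by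
      rw [R.eta_eq]; ring
    _ ≤ _ := by gcongr

theorem Run.tracking_error_le (hp : p.Valid) (hR : R.Follows p f ε) {i : ℕ}
    (hi : R.Active p f ε i) (hg : R.GainCond p i) (hM : R.ModelValid p f ε i) {t : ℝ}
    (ht : 0 ≤ t) : ‖R.x i t - p.xref t‖ ≤ R.bound p f ε i := by
  have hβ := hR.sqrtBeta_pos hp hi
  have heig := hR.eigen i hi
  have he := fun s (hs : 0 ≤ s) => hR.hasDerivWithinAt_error hp hi hs
  have he0 : (fun t => R.x i t - p.xref t) 0 = 0 := by simp [hR.start i hi]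
  have hLσ := Lsigma_nonneg (k := p.k) p.X
  -- If `ζ = 0` then `b = 0`: the error solves a homogeneous equation and stays `0`, which matches
  -- `ῡ = 0`.
  rcases (zeta_nonneg (R.U i) p.b).eq_or_lt with hζ | hζ
  · have hb := eq_zero_of_zeta_eq_zero heig.1 hζ.symm
    have h0 := eq_zero_of_linear he0 (fun s hs => by
      simpa only [hb, smul_zero, add_zero] using he s hs) ht
    rw [h0, norm_zero, R.bound_eq, ← hζ]
    simp
  · have hD := hg.denominator_pos hp hβ hζ
    set η := ⨆ t : Ici (0 : ℝ), R.eta p f ε i (p.xref t) with hη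
    have hη0 : 0 < η := (R.eta_pos hp hβ (p.xref 0)).trans_le
      (le_ciSup (R.bddAbove_eta (f := f) (ε := ε) hp i) ⟨0, le_refl (0 : ℝ)⟩)
    set v := R.bound p f ε i with hv
    -- Fixed-point form of the definition of `ῡ`; it turns `ζ G` into `-λ_max ῡ` below.
    have hvD : v * -(R.lam p i + Lsigma p.k p.X * zeta (R.U i) p.b * R.sqrtBeta p i) =
        zeta (R.U i) p.b * η := by
      rw [hv, R.bound_eq, div_mul_eq_mul_div, div_mul_cancel₀ _ hD.ne']
    have hv0 : 0 < v := by
      rw [hv, R.bound_eq]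
      exact mul_pos (div_pos hζ hD) hη0
    have hlam : R.lam p i < 0 := by
      have : 0 ≤ Lsigma p.k p.X * zeta (R.U i) p.b * R.sqrtBeta p i := by positivity
      linarith
    refine (norm_lt_of_no_first_exit (e := fun t => R.x i t - p.xref t)
      (fun s hs => (he s hs).continuousWithinAt) (fun T hT hlt => ?_) ht).le
    set G := η + Lsigma p.k p.X * R.sqrtBeta p i * v with hG
    have h1 := norm_le_of_forced heig hT hlam he0 he (G := G) (by positivity)
      (fun s hs => hM.abs_error_le hp hs.1 (hlt s hs).le)
    refine h1.trans_lt ?_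
    change zeta (R.U i) p.b * (G * ((1 - Real.exp (R.lam p i * T)) / -R.lam p i)) < v
    have h2 : zeta (R.U i) p.b * G = v * -R.lam p i := by
      rw [hG, mul_add, ← hvD]; ring
    have h3 : zeta (R.U i) p.b * (G * ((1 - Real.exp (R.lam p i * T)) / -R.lam p i)) =
        v * (1 - Real.exp (R.lam p i * T)) := by
      rw [← mul_assoc, h2, mul_assoc, mul_div_cancel₀ _ (neg_pos.2 hlam).ne']
    rw [h3]
    -- The exponential left by the zero initial error makes the inequality strict, as the first-exit
    -- argument requires.
    have := mul_pos hv0 (Real.exp_pos (R.lam p i * T))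
    linarith

end Algorithm

end EpisodicGP

end

/-! ### Union bound over the episodes. -/

theorem mainTheorem1 {d : ℕ} {Ω : Type*} [MeasurableSpace Ω] (P : Measure Ω)
    [IsProbabilityMeasure P]
    (p : EpisodicGP.Problem d) (hp : p.Valid)
    -- the unknown function is a sample of the zero mean Gaussian process with kernel `k`
    (f : Ω → EpisodicGP.State d → ℝ)
    (hf : IsGaussianProcess (fun x ω => f ω x) P)
    (hf_mean : ∀ x, ∫ ω, f ω x ∂P = 0)
    (hf_cov : ∀ x x', covariance (fun ω => f ω x) (fun ω => f ω x') P = p.k (x - x'))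
    -- i.i.d. Gaussian measurement noise, independent of the unknown function
    (ε : Ω → ℕ → ℕ → ℝ)
    (hε_law : ∀ i j, HasLaw (fun ω => ε ω i j) (gaussianReal 0 (p.son ^ 2).toNNReal) P)
    (hε_indep : iIndepFun (fun (q : ℕ × ℕ) ω => ε ω q.1 q.2) P)
    (hfε : IndepFun f (fun ω (q : ℕ × ℕ) => ε ω q.1 q.2) P)
    -- the runs of the algorithm
    (R : Ω → EpisodicGP.Run d)
    (hR : ∀ᵐ ω ∂P, (R ω).Follows p (f ω) (ε ω))
    -- the eigenvalue condition and the variance condition hold in every performed episode,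
    -- up to a failure event of probability at most `δ` per episode
    (h_init : ∀ᵐ ω ∂P, (R ω).GainCond p 0)
    (h_cond : ∀ i, 1 ≤ i → i ≤ p.maxEpisodes → P {ω | (R ω).Active p (f ω) (ε ω) i ∧
      ¬((R ω).GainCond p i ∧ (R ω).SamplingCond p (f ω) (ε ω) i)} ≤ ENNReal.ofReal p.δ) :
    ∃ S : Set Ω, MeasurableSet S ∧ ENNReal.ofReal (1 - p.maxEpisodes * p.δ) ≤ P S ∧
      ∀ ω ∈ S, ∃ n ≤ p.maxEpisodes,
        (R ω).TerminatesAfter p (f ω) (ε ω) n ∧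
        (∀ i ≤ n, (R ω).bound p (f ω) (ε ω) i ≤ p.ξ ^ i * (R ω).bound p (f ω) (ε ω) 0) ∧
        ∀ i ≤ n, (R ω).ModelValid p (f ω) (ε ω) i →
          ∀ t, 0 ≤ t → ‖(R ω).x i t - p.xref t‖ ≤ (R ω).bound p (f ω) (ε ω) i := by
  set bad : ℕ → Set Ω := fun i => {ω | (R ω).Active p (f ω) (ε ω) i ∧
    ¬((R ω).GainCond p i ∧ (R ω).SamplingCond p (f ω) (ε ω) i)} with hbad
  set null : Set Ω := {ω | ¬((R ω).Follows p (f ω) (ε ω) ∧ (R ω).GainCond p 0)} with hnull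
  have hnull0 : P null = 0 := ae_iff.1 (hR.and h_init)
  set E : Set Ω := null ∪ ⋃ i ∈ Finset.Icc 1 p.maxEpisodes, bad i with hE
  have hPE : P E ≤ ENNReal.ofReal (p.maxEpisodes * p.δ) := by
    calc P E ≤ P null + ∑ i ∈ Finset.Icc 1 p.maxEpisodes, P (bad i) :=
          (measure_union_le _ _).trans (by gcongr; exact measure_biUnion_finset_le _ _)
      _ ≤ 0 + ∑ _i ∈ Finset.Icc 1 p.maxEpisodes, ENNReal.ofReal p.δ := by
          rw [hnull0]
          gcongr with i hi
          exact h_cond i (Finset.mem_Icc.1 hi).1 (Finset.mem_Icc.1 hi).2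
      _ = ENNReal.ofReal (p.maxEpisodes * p.δ) := by
          rw [ENNReal.ofReal_mul (by positivity)]
          simp
  -- The failure events are not assumed measurable, so the good event is the complement of a
  -- measurable hull of the same measure.
  refine ⟨(toMeasurable P E)ᶜ, (measurableSet_toMeasurable P E).compl, ?_, fun ω hω => ?_⟩
  · rw [prob_compl_eq_one_sub (measurableSet_toMeasurable P E), measure_toMeasurable,
      ENNReal.ofReal_sub _ (mul_nonneg (Nat.cast_nonneg _) hp.δ_mem.1.le), ENNReal.ofReal_one]
    exact tsub_le_tsub_left hPE 1
  · have hωE : ω ∉ E := fun h => hω (subset_toMeasurable P E h)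
    have hgood : (R ω).Follows p (f ω) (ε ω) ∧ (R ω).GainCond p 0 := by
      by_contra h
      exact hωE (Or.inl h)
    have hcond : ∀ i, 1 ≤ i → i ≤ p.maxEpisodes → (R ω).Active p (f ω) (ε ω) i →
        (R ω).GainCond p i ∧ (R ω).SamplingCond p (f ω) (ε ω) i := by
      intro i h1 hi ha
      by_contra h
      exact hωE (Or.inr (mem_biUnion (Finset.mem_Icc.2 ⟨h1, hi⟩) ⟨ha, h⟩))
    obtain ⟨n, hn, hterm, hdecay⟩ :=
      (R ω).exists_terminatesAfter hp hgood.1 hgood.2 hcond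
    refine ⟨n, hn, hterm, hdecay, fun i hi hM t ht => ?_⟩
    have ha : (R ω).Active p (f ω) (ε ω) i := fun j hj => hterm.1 j (hj.trans_le hi)
    refine (R ω).tracking_error_le hp hgood.1 ha ?_ hM ht
    rcases Nat.eq_zero_or_pos i with rfl | hpos
    · exact hgood.2
    · exact (hcond i hpos (hi.trans hn) ha).1
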